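/- Setting. Let $\mathcal H=\bigotimes_{s\in I}\mathbb C^{d_s}$ be the finite-dimensional Hilbert space of finitely many subsystems, let $j\neq k$ be two subsystems with $d_j=d_k$ whose local bases are identified, and let $P_{j,k}$ be the operator that exchanges $j$ and $k$ in the product basis (so $P_{j,k}^2=\mathbb 1$). For an operator $O$ on $\mathbb C^{d_j}$ let $O_j$ and $O_k=P_{j,k}O_jP_{j,k}$ be the operators that act as $O$ on subsystem $j$, respectively $k$, and as the identity elsewhere. Let $H$ be Hermitian, let $(L_\mu)$ be a finite family of operators on $\mathcal H$, and let $$\hat{\mathcal L}[\rho]=-\mathrm i[H,\rho]+\sum_\mu\bigl(2L_\mu\rho L_\mu^\dagger-\{L_\mu^\dagger L_\mu,\rho\}\bigr).$$ For $\omega\in\mathbb R$ say that $(A,\rho_\infty,\omega)$ satisfies $(\ast)$ if $A$ is unitary, $\rho_\infty$ is a density operator with $\hat{\mathcal L}[\rho_\infty]=0$, $[L_\mu,A]\rho_\infty=0$ for all $\mu$, and $$\Bigl(-\mathrm i[H,A]-\sum_\mu[L_\mu^\dagger,A]L_\mu\Bigr)\rho_\infty=\mathrm i\omega A\rho_\infty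 .$$ Corollary. Suppose that 1. $P_{j,k}$ is a weak symmetry of $\hat{\mathcal L}$, that is, $\hat{\mathcal L}[P_{j,k}XP_{j,k}]=P_{j,k}\hat{\mathcal L}[X]P_{j,k}$ for all operators $X$; 2. there is at least one $(A,\rho_\infty,\omega)$ satisfying $(\ast)$ with $\omega\neq0$; 3. for at least one $(A,\rho_\infty,\omega)$ satisfying $(\ast)$ with $\omega\ne0$ we have $\operatorname{tr}[O_jA\rho_\infty]\neq0$; 4. for every $(A,\rho_\infty,\omega)$ satisfying $(\ast)$, $\omega\in\mathbb R$ arbitrary ($\omega=0$ included), $A$ commutes with $P_{j,k}$ on the range of $\rho_\infty$, that is, $[P_{j,k},A]\rho_\infty=0$. Then subsystems $j$ and $k$ are robustly and stably synchronized in $O$. Here $f\simeq g$, for signals $f,g$ with values in $\mathbb C$ or in the operators on $\mathcal H$, means that $\|f(t)-g(t)\|\le Ce^{-\gamma t}$ for all $t\ge\tau$, for some $\tau,C\in\mathbb R$ and $\gamma>0$; $f$ is called non-stationary if $f\not\simeq c$ for every constant $c$ and $\partial_tf\not\simeq0$; and the claim is: * (stable) for some initial density operator $\rho_0$, with $\langle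 B(t)\rangle=\operatorname{tr}(B\,e^{t\hat{\mathcal L}}[\rho_0])$, we have $\langle O_j(t)\rangle\simeq\langle O_k(t)\rangle$, and $\langle O_j(t)\rangle$ is non-stationary; * (robust) for the Heisenberg-picture operators $B(t)=e^{t\hat{\mathcal L}^\dagger}[B]$, where $\hat{\mathcal L}^\dagger$ is the Hilbert–Schmidt adjoint of $\hat{\mathcal L}$, we have $O_j(t)\simeq P_{j,k}O_k(t)P_{j,k}$ and $O_j(t)\simeq O_k(t)$ (so that the two expectation values agree, in the sense of $\simeq$, for every initial state), and $O_j(t)$ is non-stationary. -/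

import Mathlib

open Matrix
open scoped ComplexOrder Matrix.Norms.L2Operator

noncomputable section

namespace QuantumSync

/-! ## Lindblad dynamics on a finite-dimensional Hilbert space `ℂⁿ` -/

section Lindblad

variable {n μ : Type*} [Fintype n] [DecidableEq n] [Fintype μ]

/-- The Liouvillian `ℒ[X] = -i[H, X] + ∑_μ (2 L_μ X L_μ† - {L_μ† L_μ, X})`. -/
def liouvillian (H : Matrix n n ℂ) (L : μ → Matrix n n ℂ) :
    Matrix n n ℂ →ₗ[ℂ] Matrix n n ℂ where
  toFun X := -Complex.I • (H * X - X * H) +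
    ∑ m, ((2 : ℂ) • (L m * X * (L m)ᴴ) - ((L m)ᴴ * L m * X + X * ((L m)ᴴ * L m)))
  map_add' X Y := by
    rw [add_add_add_comm, ← Finset.sum_add_distrib, ← smul_add]
    congr 1
    · congr 1; noncomm_ring
    · refine Finset.sum_congr rfl fun m _ => ?_
      simp only [mul_add, add_mul, smul_add]; abel
  map_smul' c X := by
    simp only [RingHom.id_apply, smul_add, Finset.smul_sum, Matrix.mul_smul, Matrix.smul_mul,
      smul_sub, smul_comm c]

/-- The Hilbert-Schmidt adjoint
`ℒ†[X] = i[H, X] + ∑_μ (2 L_μ† X L_μ - {L_μ† L_μ, X})` (for Hermitian `H`), which generates the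
Heisenberg picture. -/
def adjointLiouvillian (H : Matrix n n ℂ) (L : μ → Matrix n n ℂ) :
    Matrix n n ℂ →ₗ[ℂ] Matrix n n ℂ where
  toFun X := Complex.I • (H * X - X * H) +
    ∑ m, ((2 : ℂ) • ((L m)ᴴ * X * L m) - ((L m)ᴴ * L m * X + X * ((L m)ᴴ * L m)))
  map_add' X Y := by
    rw [add_add_add_comm, ← Finset.sum_add_distrib, ← smul_add]
    congr 1
    · congr 1; noncomm_ring
    · refine Finset.sum_congr rfl fun m _ => ?_
      simp only [mul_add, add_mul, smul_add]; abel
  map_smul' c X := by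
    simp only [RingHom.id_apply, smul_add, Finset.smul_sum, Matrix.mul_smul, Matrix.smul_mul,
      smul_sub, smul_comm c]

/-- The flow `e^{tG}[X]` of a linear superoperator `G`. -/
def flow (G : Matrix n n ℂ →ₗ[ℂ] Matrix n n ℂ) (t : ℝ) (X : Matrix n n ℂ) : Matrix n n ℂ :=
  NormedSpace.exp ((t : ℂ) • LinearMap.toContinuousLinearMap G) X

/-- Density operators: positive semidefinite with unit trace. -/
def IsDensity (ρ : Matrix n n ℂ) : Prop := ρ.PosSemidef ∧ ρ.trace = 1

/-- The expectation value `⟨B(t)⟩ = tr[B e^{tℒ}[ρ₀]]`, started in `ρ₀` at time `0`. -/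
def expectation (H : Matrix n n ℂ) (L : μ → Matrix n n ℂ) (B ρ₀ : Matrix n n ℂ) (t : ℝ) : ℂ :=
  (B * flow (liouvillian H L) t ρ₀).trace

/-- The Heisenberg-picture operator `B(t) = e^{tℒ†}[B]`. -/
def heisenberg (H : Matrix n n ℂ) (L : μ → Matrix n n ℂ) (B : Matrix n n ℂ) (t : ℝ) :
    Matrix n n ℂ :=
  flow (adjointLiouvillian H L) t B

/-- A (proper) non-equilibrium steady state: a density operator with `ℒ[ρ] = 0`. -/
def IsNESS (H : Matrix n n ℂ) (L : μ → Matrix n n ℂ) (ρ : Matrix n n ℂ) : Prop :=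
  IsDensity ρ ∧ liouvillian H L ρ = 0

/-- The conditions under which `A ρ∞` is an eigenstate of `ℒ` with eigenvalue `i ω`, `ω ∈ ℝ`:
`A` is unitary, `ρ∞` is a NESS, `[L_μ, A] ρ∞ = 0` for all `μ`, and
`(-i[H, A] - ∑_μ [L_μ†, A] L_μ) ρ∞ = i ω A ρ∞`. -/
structure IsOscillating (H : Matrix n n ℂ) (L : μ → Matrix n n ℂ)
    (A ρ : Matrix n n ℂ) (ω : ℝ) : Prop where
  unitary : A ∈ Matrix.unitaryGroup n ℂ
  ness : IsNESS H L ρ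
  comm : ∀ m, (L m * A - A * L m) * ρ = 0
  eigen : (-Complex.I • (H * A - A * H) - ∑ m, ((L m)ᴴ * A - A * (L m)ᴴ) * L m) * ρ =
    (Complex.I * (ω : ℂ)) • (A * ρ)

/-- `P` is a weak symmetry of `ℒ`: the superoperator `X ↦ P X P` commutes with `ℒ`. -/
def IsWeakSymmetry (H : Matrix n n ℂ) (L : μ → Matrix n n ℂ) (P : Matrix n n ℂ) : Prop :=
  ∀ X, liouvillian H L (P * X * P) = P * liouvillian H L X * P

end Lindblad

/-! ## Long-time behaviour of signals -/

section Signals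

variable {V : Type*} [NormedAddCommGroup V] [NormedSpace ℝ V]

/-- After a transient time `τ`, the signals agree up to exponentially small terms in time. -/
def EventuallyEq (f g : ℝ → V) : Prop :=
  ∃ τ C γ : ℝ, 0 < γ ∧ ∀ t, τ ≤ t → ‖f t - g t‖ ≤ C * Real.exp (-γ * t)

/-- The signal does not become constant, and its time derivative does not become zero (both up to
exponentially small terms in time). -/
def IsNonstationary (f : ℝ → V) : Prop :=
  (∀ c : V, ¬ EventuallyEq f fun _ => c) ∧ ¬ EventuallyEq (deriv f) fun _ => 0

end Signals

/-! ## Composite systems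

The Hilbert space is `⨂ₛ ℂ^(κ s)` over the subsystems `s : ι`; its product basis is indexed by the
configurations `Π s, κ s`. -/

section Composite

variable {ι : Type*} [Fintype ι] [DecidableEq ι] {κ : ι → Type*} [∀ s, Fintype (κ s)]
  [∀ s, DecidableEq (κ s)]

/-- `O` acting on subsystem `j`: `𝟙 ⊗ ⋯ ⊗ O ⊗ ⋯ ⊗ 𝟙`. -/
def onSubsystem (j : ι) (O : Matrix (κ j) (κ j) ℂ) : Matrix (∀ s, κ s) (∀ s, κ s) ℂ :=
  Matrix.of fun x y => if ∀ s, s ≠ j → x s = y s then O (x j) (y j) else 0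

/-- Exchange the entries of a configuration at `j` and `k`, whose local bases are identified
by `e`. -/
def exchangeConfig (j k : ι) (e : κ j ≃ κ k) (x : ∀ s, κ s) : ∀ s, κ s :=
  Function.update (Function.update x j (e.symm (x k))) k (e (x j))

/-- The operator `P_{j,k}` exchanging subsystems `j` and `k`, `P |x⟩ = |exchangeConfig x⟩`. -/
def exchange (j k : ι) (e : κ j ≃ κ k) : Matrix (∀ s, κ s) (∀ s, κ s) ℂ :=
  Matrix.of fun x y => if x = exchangeConfig j k e y then 1 else 0

variable {μ : Type*} [Fintype μ]

/-- Subsystems `j` and `k` are stably synchronized in `O`: for some initial state, after a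
transient, `⟨O_j(t)⟩ = ⟨O_k(t)⟩`, and this signal does not become constant. -/
def StablySynchronized (H : Matrix (∀ s, κ s) (∀ s, κ s) ℂ)
    (L : μ → Matrix (∀ s, κ s) (∀ s, κ s) ℂ) (j k : ι) (e : κ j ≃ κ k)
    (O : Matrix (κ j) (κ j) ℂ) : Prop :=
  ∃ ρ₀, IsDensity ρ₀ ∧
    EventuallyEq (expectation H L (onSubsystem j O) ρ₀)
      (expectation H L (onSubsystem k (O.reindex e e)) ρ₀) ∧
    IsNonstationary (expectation H L (onSubsystem j O) ρ₀)

/-- Subsystems `j` and `k` are robustly (and stably) synchronized in `O`: they are stably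
synchronized and, after a transient, equality and non-stationarity hold on the operator level in
the Heisenberg picture. Equality is required in both forms `O_j(t) = P O_k(t) P` and
`O_j(t) = O_k(t)`; the latter is what makes the two signals agree for every initial state. -/
structure RobustlyStablySynchronized (H : Matrix (∀ s, κ s) (∀ s, κ s) ℂ)
    (L : μ → Matrix (∀ s, κ s) (∀ s, κ s) ℂ) (j k : ι) (e : κ j ≃ κ k)
    (O : Matrix (κ j) (κ j) ℂ) : Prop where
  stable : StablySynchronized H L j k e O
  exchange_eq : EventuallyEq (heisenberg H L (onSubsystem j O))
    fun t => exchange j k e * heisenberg H L (onSubsystem k (O.reindex e e)) t * exchange j k e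
  operator_eq : EventuallyEq (heisenberg H L (onSubsystem j O))
    (heisenberg H L (onSubsystem k (O.reindex e e)))
  nonstationary : IsNonstationary (heisenberg H L (onSubsystem j O))

end Composite

end QuantumSync

end

/-! What survives at long times is carried by the eigenmatrices of `ℒ` whose eigenvalue lies on the
imaginary axis, and everything rests on the polar decomposition `X = U R` of such an eigenmatrix.

For unitary `U`, a second-order difference of `ℒ` equals `∑ 2 C R Cᴴ` with `C = Uᴴ L_μ U - L_μ`
(`liouvillian_unitary_identity`). Since `ℒ` has traceless values, taking traces gives `Re tr (Uᴴ ℒ[U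
R]) ≤ 0`, the infinitesimal form of trace-norm contractivity. Hence no eigenvalue has positive real
part, and those on the axis have no Jordan blocks (`semisimple_of_re_eq_zero`). For an eigenvalue
`iω` equality holds, so `C R = 0`; this forces `ℒ[R] = 0`, and after normalization `(U, R)` is
oscillating (`exists_isOscillating`).

The commutation hypothesis therefore controls every eigenmatrix on the axis. Applied at `ω = 0` it
makes all stationary matrices invariant under the exchange `P`; applied at general `ω` it makes
every `A ρ∞` invariant (`conj_eq_self_of_eigen`). So `O_j - O_k`, where `O_k = P O_j P`, is
trace-orthogonal to all these eigenmatrices, and only exponentially decaying modes contribute to its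
evolution. Non-stationarity comes from the component `tr (O_j A ρ∞) ≠ 0` at frequency `ω ≠ 0`: in
the Heisenberg picture by pairing with `A ρ∞`, and for expectation values in the state `½ (1 + A) ρ∞
(1 + A)ᴴ`. -/

noncomputable section

namespace QuantumSync

/-! ### Polar decomposition and positivity. -/

section Matrices

variable {n : Type*} [Fintype n] [DecidableEq n]

/-- Polar decomposition of a square complex matrix, with a unitary (not just partially isometric)
factor. -/
theorem exists_polar_decomposition (X : Matrix n n ℂ) :
    ∃ U R : Matrix n n ℂ, Uᴴ * U = 1 ∧ U * Uᴴ = 1 ∧ R.PosSemidef ∧ X = U * R := by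
  obtain ⟨R, hR, hRX⟩ : ∃ R : Matrix n n ℂ, R.PosSemidef ∧ R * R = Xᴴ * X := by
    open scoped MatrixOrder in
    have h : (0 : Matrix n n ℂ) ≤ Xᴴ * X :=
      Matrix.nonneg_iff_posSemidef.2 (Matrix.posSemidef_conjTranspose_mul_self X)
    exact ⟨CFC.sqrt (Xᴴ * X), Matrix.nonneg_iff_posSemidef.1 (CFC.sqrt_nonneg _),
      CFC.sqrt_mul_sqrt_self _ h⟩
  let Φ := Matrix.toEuclideanCLM (n := n) (𝕜 := ℂ)
  have hnorm : ∀ v, ‖Φ X v‖ = ‖Φ R v‖ := by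
    have key : star (Φ X) * Φ X = star (Φ R) * Φ R := by
      rw [← map_star, ← map_star, ← map_mul, ← map_mul, Matrix.star_eq_conjTranspose,
        Matrix.star_eq_conjTranspose, hR.isHermitian.eq, hRX]
    intro v
    rw [← sq_eq_sq₀ (norm_nonneg _) (norm_nonneg _),
      ContinuousLinearMap.apply_norm_sq_eq_inner_adjoint_left,
      ContinuousLinearMap.apply_norm_sq_eq_inner_adjoint_left]
    exact congrArg (fun T : EuclideanSpace ℂ n →L[ℂ] EuclideanSpace ℂ n =>
      RCLike.re (inner ℂ (T v) v)) key
  let r : EuclideanSpace ℂ n →ₗ[ℂ] EuclideanSpace ℂ n := (Φ R).toLinearMap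
  let f : EuclideanSpace ℂ n →ₗ[ℂ] EuclideanSpace ℂ n := (Φ X).toLinearMap
  have hfr : ∀ v, ‖f v‖ = ‖r v‖ := hnorm
  obtain ⟨g, hg⟩ := r.rangeRestrict.exists_rightInverse_of_surjective
    (LinearMap.range_rangeRestrict r)
  have hg' : ∀ y, r (g y) = y := fun y => congrArg Subtype.val (LinearMap.congr_fun hg y)
  -- The assignment `R v ↦ X v` is a well-defined isometry on the range of `R` because `‖X v‖ = ‖R
  -- v‖`. Any isometric extension to the whole finite-dimensional space is unitary.
  let W : r.range →ₗᵢ[ℂ] EuclideanSpace ℂ n :=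
    ⟨f ∘ₗ g, fun y => by
      rw [LinearMap.comp_apply, hfr, hg']; rfl⟩
  have hW : ∀ v, W.extend (r v) = f v := by
    intro v
    have h1 := W.extend_apply (r.rangeRestrict v)
    have h2 : f (g (r.rangeRestrict v)) = f v := by
      rw [← sub_eq_zero, ← map_sub, ← norm_eq_zero, hfr, map_sub, hg', norm_eq_zero, sub_eq_zero]
      rfl
    exact h1.trans h2
  let T := W.extend.toContinuousLinearMap
  have hT : star T * T = 1 :=
    (ContinuousLinearMap.norm_map_iff_adjoint_comp_self T).1 fun v => W.extend.norm_map v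
  have hmul : ∀ A B, Φ (A * B) = Φ A * Φ B := map_mul Φ
  obtain ⟨U, hUT⟩ : ∃ U, Φ U = T := Φ.surjective T
  have hU : Uᴴ * U = 1 := by
    apply EquivLike.injective Φ
    rw [← Matrix.star_eq_conjTranspose, hmul, (map_star Φ U : Φ (star U) = star (Φ U)), hUT, hT,
      (map_one Φ : Φ 1 = 1)]
  refine ⟨U, R, hU, mul_eq_one_comm.1 hU, hR, ?_⟩
  apply EquivLike.injective Φ
  rw [hmul, hUT]
  ext1 v
  exact (hW v).symm

theorem mul_eq_zero_of_mul_mul_conjTranspose_eq_zero {R : Matrix n n ℂ} (hR : R.PosSemidef)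
    {C : Matrix n n ℂ} (h : C * R * Cᴴ = 0) : C * R = 0 := by
  obtain ⟨B, rfl⟩ : ∃ B : Matrix n n ℂ, R = Bᴴ * B := by
    open scoped MatrixOrder in
    exact CStarAlgebra.nonneg_iff_eq_star_mul_self.1 (Matrix.nonneg_iff_posSemidef.2 hR)
  have h2 : (C * Bᴴ) * (C * Bᴴ)ᴴ = 0 := by
    rw [conjTranspose_mul, conjTranspose_conjTranspose, ← h]; noncomm_ring
  rw [← mul_assoc, self_mul_conjTranspose_eq_zero.1 h2, zero_mul]

/-- A Hermitian matrix anticommuting with a positive semidefinite one annihilates it. -/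
theorem mul_eq_zero_of_anticommute {R Z : Matrix n n ℂ} (hR : R.PosSemidef) (hZ : Zᴴ = Z)
    (h : R * Z = -(Z * R)) : Z * R = 0 := by
  refine mul_eq_zero_of_mul_mul_conjTranspose_eq_zero hR ?_
  rw [← (hR.mul_mul_conjTranspose_same Z).trace_eq_zero_iff, hZ]
  have h1 : (Z * R * Z).trace = -(Z * R * Z).trace := by
    calc (Z * R * Z).trace = (Z * (Z * R)).trace := trace_mul_comm _ _
      _ = -(Z * (R * Z)).trace := by rw [h, mul_neg, trace_neg, neg_neg]
      _ = _ := by rw [mul_assoc]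
  exact self_eq_neg.1 h1

end Matrices

/-! ### Eigenmatrices of `ℒ` with imaginary eigenvalue. -/

section Lindblad

variable {n μ : Type*} [Fintype n] [DecidableEq n] [Fintype μ]

theorem liouvillian_apply (H : Matrix n n ℂ) (L : μ → Matrix n n ℂ) (X : Matrix n n ℂ) :
    liouvillian H L X = -Complex.I • (H * X - X * H) +
    ∑ m, ((2 : ℂ) • (L m * X * (L m)ᴴ) - ((L m)ᴴ * L m * X + X * ((L m)ᴴ * L m))) := rfl

theorem adjointLiouvillian_apply (H : Matrix n n ℂ) (L : μ → Matrix n n ℂ) (X : Matrix n n ℂ) :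
    adjointLiouvillian H L X = Complex.I • (H * X - X * H) +
    ∑ m, ((2 : ℂ) • ((L m)ᴴ * X * L m) - ((L m)ᴴ * L m * X + X * ((L m)ᴴ * L m))) := rfl

theorem liouvillian_conjTranspose {H : Matrix n n ℂ} (hH : H.IsHermitian)
    (L : μ → Matrix n n ℂ) (X : Matrix n n ℂ) :
    liouvillian H L Xᴴ = (liouvillian H L X)ᴴ := by
  simp only [liouvillian_apply, conjTranspose_add, conjTranspose_smul, conjTranspose_sum,
    conjTranspose_sub, conjTranspose_mul, conjTranspose_conjTranspose, hH.eq]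
  congr 1
  · simp only [star_neg, RCLike.star_def, Complex.conj_I]
    module
  · refine Finset.sum_congr rfl fun m _ => ?_
    simp only [RCLike.star_def, map_ofNat, mul_assoc]
    abel

theorem trace_mul_liouvillian (H : Matrix n n ℂ) (L : μ → Matrix n n ℂ) (B X : Matrix n n ℂ) :
    (B * liouvillian H L X).trace = (adjointLiouvillian H L B * X).trace := by
  simp only [liouvillian_apply, adjointLiouvillian_apply, mul_add, add_mul, trace_add,
    Finset.mul_sum, Finset.sum_mul, trace_sum]
  congr 1
  · simp only [Matrix.mul_smul, Matrix.smul_mul, trace_smul, mul_sub, sub_mul, trace_sub]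
    rw [← mul_assoc B X H, trace_mul_cycle B X H, ← mul_assoc B H X, smul_eq_mul, smul_eq_mul]
    ring
  · refine Finset.sum_congr rfl fun m _ => ?_
    simp only [Matrix.mul_smul, Matrix.smul_mul, trace_smul, mul_sub, sub_mul, trace_sub, mul_add,
      add_mul, trace_add]
    have h1 : (B * (L m * X * (L m)ᴴ)).trace = ((L m)ᴴ * B * L m * X).trace := by
      rw [← mul_assoc, trace_mul_comm]; simp only [mul_assoc]
    have h2 : (B * (X * ((L m)ᴴ * L m))).trace = ((L m)ᴴ * L m * B * X).trace := by
      rw [← mul_assoc, trace_mul_comm]; simp only [mul_assoc]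
    rw [h1, h2, ← mul_assoc B]
    ring

theorem trace_liouvillian (H : Matrix n n ℂ) (L : μ → Matrix n n ℂ) (X : Matrix n n ℂ) :
    (liouvillian H L X).trace = 0 := by
  rw [← one_mul (liouvillian H L X), trace_mul_liouvillian, adjointLiouvillian_apply]
  have : (∑ m, ((2 : ℂ) • ((L m)ᴴ * 1 * L m) - ((L m)ᴴ * L m * 1 + 1 * ((L m)ᴴ * L m)))) = 0 :=
    Finset.sum_eq_zero fun m _ => by simp only [mul_one, one_mul]; module
  rw [this]
  simp

/-- The second-order difference of `ℒ` along a unitary is a sum of positive terms. -/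
theorem liouvillian_unitary_identity (H : Matrix n n ℂ) (L : μ → Matrix n n ℂ)
    {U : Matrix n n ℂ} (hU : Uᴴ * U = 1) (R : Matrix n n ℂ) :
    Uᴴ * liouvillian H L (U * R * Uᴴ) * U + liouvillian H L R - Uᴴ * liouvillian H L (U * R)
      - liouvillian H L (R * Uᴴ) * U =
    ∑ m, (2 : ℂ) • ((Uᴴ * L m * U - L m) * R * (Uᴴ * L m * U - L m)ᴴ) := by
  have hU' : ∀ Z, Uᴴ * (U * Z) = Z := fun Z => by rw [← mul_assoc, hU, one_mul]
  simp only [liouvillian_apply, mul_add, add_mul, Finset.mul_sum, Finset.sum_mul,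
    Matrix.mul_smul, Matrix.smul_mul, mul_sub, sub_mul, smul_sub, mul_assoc, hU, hU', mul_one,
    conjTranspose_sub, conjTranspose_mul, conjTranspose_conjTranspose, Finset.sum_sub_distrib,
    Finset.sum_add_distrib]
  abel

/-- Leibniz-type expansion of `ℒ[A R]`, for `[L_μ, A] R = 0`. -/
theorem liouvillian_mul (H : Matrix n n ℂ) (L : μ → Matrix n n ℂ) {A R : Matrix n n ℂ}
    (hcomm : ∀ m, (L m * A - A * L m) * R = 0) :
    liouvillian H L (A * R) = A * liouvillian H L R +
      (-Complex.I • (H * A - A * H) - ∑ m, ((L m)ᴴ * A - A * (L m)ᴴ) * L m) * R := by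
  have hc : ∀ m, L m * (A * R) = A * (L m * R) := fun m => by
    have := hcomm m
    rw [sub_mul, sub_eq_zero] at this
    simpa only [mul_assoc] using this
  simp only [liouvillian_apply, mul_add, Finset.mul_sum, Finset.sum_mul,
    Matrix.mul_smul, Matrix.smul_mul, mul_sub, sub_mul, smul_sub, mul_assoc, hc,
    Finset.sum_sub_distrib, Finset.sum_add_distrib]
  abel

theorem IsOscillating.liouvillian_eq {H : Matrix n n ℂ} {L : μ → Matrix n n ℂ}
    {A ρ : Matrix n n ℂ} {ω : ℝ} (h : IsOscillating H L A ρ ω) :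
    liouvillian H L (A * ρ) = (Complex.I * (ω : ℂ)) • (A * ρ) := by
  rw [liouvillian_mul H L h.comm, h.eigen, h.ness.2, mul_zero, zero_add]

theorem trace_polar_add_star {H : Matrix n n ℂ} (hH : H.IsHermitian) (L : μ → Matrix n n ℂ)
    {U R : Matrix n n ℂ} (hU : Uᴴ * U = 1) (hU' : U * Uᴴ = 1) (hR : R.PosSemidef) :
    (Uᴴ * liouvillian H L (U * R)).trace + star (Uᴴ * liouvillian H L (U * R)).trace =
      -∑ m, 2 * ((Uᴴ * L m * U - L m) * R * (Uᴴ * L m * U - L m)ᴴ).trace := by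
  have h := congrArg trace (liouvillian_unitary_identity H L hU R)
  have h1 : (Uᴴ * liouvillian H L (U * R * Uᴴ) * U).trace = 0 := by
    rw [trace_mul_comm, ← mul_assoc, hU', one_mul, trace_liouvillian]
  have h2 : (liouvillian H L (R * Uᴴ) * U).trace =
      star (Uᴴ * liouvillian H L (U * R)).trace := by
    rw [← trace_conjTranspose, conjTranspose_mul, conjTranspose_conjTranspose,
      ← liouvillian_conjTranspose hH, conjTranspose_mul, hR.isHermitian.eq]
  rw [trace_sub, trace_sub, trace_add, h1, h2, trace_liouvillian, trace_sum] at h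
  simp only [trace_smul, smul_eq_mul] at h
  rw [← h]
  ring

/-- Infinitesimal trace-norm contractivity: `tr (Uᴴ X)` is the trace norm of `X = U R`, and its rate
of change under `ℒ` with `U` held fixed has nonpositive real part. -/
theorem re_trace_polar_nonpos {H : Matrix n n ℂ} (hH : H.IsHermitian) (L : μ → Matrix n n ℂ)
    {U R : Matrix n n ℂ} (hU : Uᴴ * U = 1) (hU' : U * Uᴴ = 1) (hR : R.PosSemidef) :
    (Uᴴ * liouvillian H L (U * R)).trace.re ≤ 0 := by
  have h := congrArg Complex.re (trace_polar_add_star hH L hU hU' hR)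
  have h2 : 0 ≤ (∑ m, 2 * ((Uᴴ * L m * U - L m) * R * (Uᴴ * L m * U - L m)ᴴ).trace).re :=
    (Complex.le_def.1 (Finset.sum_nonneg fun m _ => mul_nonneg (by norm_num)
      (hR.mul_mul_conjTranspose_same (Uᴴ * L m * U - L m)).trace_nonneg)).1
  simp only [RCLike.star_def, Complex.add_re, Complex.conj_re, Complex.neg_re] at h
  linarith

/-- The polar factors of an eigenmatrix of `ℒ` with purely imaginary eigenvalue. -/
theorem polar_of_eigen {H : Matrix n n ℂ} (hH : H.IsHermitian) (L : μ → Matrix n n ℂ)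
    {U R : Matrix n n ℂ} (hU : Uᴴ * U = 1) (hU' : U * Uᴴ = 1) (hR : R.PosSemidef) {ω : ℝ}
    (hX : liouvillian H L (U * R) = (Complex.I * (ω : ℂ)) • (U * R)) :
    liouvillian H L R = 0 ∧ (∀ m, (L m * U - U * L m) * R = 0) ∧
    (-Complex.I • (H * U - U * H) - ∑ m, ((L m)ᴴ * U - U * (L m)ᴴ) * L m) * R =
      (Complex.I * (ω : ℂ)) • (U * R) := by
  have hUc : ∀ Z, Uᴴ * (U * Z) = Z := fun Z => by rw [← mul_assoc, hU, one_mul]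
  have hUc' : ∀ Z, U * (Uᴴ * Z) = Z := fun Z => by rw [← mul_assoc, hU', one_mul]
  -- Since `iω tr R` is purely imaginary, the sum of nonnegative traces vanishes, hence each of its
  -- terms does.
  have hC : ∀ m, (Uᴴ * L m * U - L m) * R = 0 := by
    have h := trace_polar_add_star hH L hU hU' hR
    rw [hX, Matrix.mul_smul, hUc, trace_smul, smul_eq_mul, star_mul', ← trace_conjTranspose,
      hR.isHermitian.eq] at h
    have h0 : ∑ m, 2 * ((Uᴴ * L m * U - L m) * R * (Uᴴ * L m * U - L m)ᴴ).trace = 0 := by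
      rw [← neg_eq_zero, ← h]
      simp
    intro m
    have hm := (Finset.sum_eq_zero_iff_of_nonneg fun m _ => mul_nonneg (by norm_num)
      (hR.mul_mul_conjTranspose_same (Uᴴ * L m * U - L m)).trace_nonneg).1 h0 m
      (Finset.mem_univ m)
    exact mul_eq_zero_of_mul_mul_conjTranspose_eq_zero hR
      ((hR.mul_mul_conjTranspose_same _).trace_eq_zero_iff.1
        ((mul_eq_zero.1 hm).resolve_left two_ne_zero))
  have hcomm : ∀ m, (L m * U - U * L m) * R = 0 := fun m => by
    have := congrArg (U * ·) (hC m)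
    simpa only [sub_mul, mul_sub, mul_assoc, hUc', mul_zero] using this
  have hC' : ∀ m, R * ((Uᴴ * (L m)ᴴ * U - (L m)ᴴ)) = 0 := fun m => by
    have := congrArg conjTranspose (hC m)
    simpa only [conjTranspose_mul, conjTranspose_sub, conjTranspose_conjTranspose,
      hR.isHermitian.eq, conjTranspose_zero, mul_assoc] using this
  have hexp := liouvillian_mul H L hcomm
  rw [hX] at hexp
  set E := -Complex.I • (H * U - U * H) - ∑ m, ((L m)ᴴ * U - U * (L m)ᴴ) * L m with hE
  set Z := liouvillian H L R with hZ
  have hZR : Z = ((Complex.I * (ω : ℂ)) • 1 - Uᴴ * E) * R := by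
    have := congrArg (Uᴴ * ·) hexp
    simp only [Matrix.mul_smul, mul_add, hUc] at this
    rw [sub_mul, Matrix.smul_mul, one_mul, this, mul_assoc]
    abel
  have hZh : Zᴴ = Z := by
    rw [hZ, ← liouvillian_conjTranspose hH, hR.isHermitian.eq]
  have hRE : R * (Uᴴ * E) = -Complex.I • (R * (Uᴴ * H * U - H)) := by
    have h0 : R * (Uᴴ * ∑ m, ((L m)ᴴ * U - U * (L m)ᴴ) * L m) = 0 := by
      rw [Finset.mul_sum, Finset.mul_sum]
      refine Finset.sum_eq_zero fun m _ => ?_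
      have := congrArg (· * L m) (hC' m)
      simpa only [sub_mul, mul_sub, mul_assoc, hUc, zero_mul] using this
    rw [hE, mul_sub, mul_sub, h0, sub_zero, Matrix.mul_smul, Matrix.mul_smul, mul_sub, hUc,
      mul_assoc]
  have hRZ : R * Z = Complex.I • (R * (((ω : ℂ) • 1 + (Uᴴ * H * U - H)) * R)) := by
    rw [hZR, ← mul_assoc, mul_sub, hRE]
    simp only [Matrix.mul_smul, sub_mul, add_mul, mul_add, Matrix.smul_mul, mul_one, one_mul,
      mul_sub, mul_assoc]
    module
  -- By `hRZ`, `R Z` is `i` times a Hermitian matrix, so it is anti-Hermitian, while `R` and `Z` are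
  -- both Hermitian.
  have hanti : R * Z = -(Z * R) := by
    have h1 := congrArg conjTranspose hRZ
    rw [conjTranspose_mul, hZh, hR.isHermitian.eq] at h1
    rw [h1, hRZ]
    simp only [conjTranspose_smul, conjTranspose_mul, conjTranspose_add, conjTranspose_sub,
      conjTranspose_one, conjTranspose_conjTranspose, hH.eq, hR.isHermitian.eq, RCLike.star_def,
      Complex.conj_I, Complex.conj_ofReal, neg_smul, neg_neg, mul_assoc]
  have hZR0 := mul_eq_zero_of_anticommute hR hZh hanti
  have hRZ0 : R * Z = 0 := by rw [hanti, hZR0, neg_zero]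
  -- `R Z = 0` alone leaves room for `Z` on the kernel of `R`; the factorization `Z = (⋯) R` from
  -- `hZR` excludes it.
  have hZ0 : Z = 0 := by
    have : Z * Zᴴ = 0 := by
      calc Z * Zᴴ = ((Complex.I * (ω : ℂ)) • 1 - Uᴴ * E) * (R * Z) := by
            rw [hZh, ← mul_assoc, ← hZR]
        _ = 0 := by rw [hRZ0, mul_zero]
    exact self_mul_conjTranspose_eq_zero.1 this
  refine ⟨hZ0, hcomm, ?_⟩
  rw [hexp, hZ0, mul_zero, zero_add]

/-- Every eigenmatrix of `ℒ` with purely imaginary eigenvalue is a multiple of `A ρ∞` for some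
oscillating `(A, ρ∞)`. -/
theorem exists_isOscillating {H : Matrix n n ℂ} (hH : H.IsHermitian) (L : μ → Matrix n n ℂ)
    {X : Matrix n n ℂ} {ω : ℝ} (hX : liouvillian H L X = (Complex.I * (ω : ℂ)) • X)
    (hX0 : X ≠ 0) :
    ∃ A ρ : Matrix n n ℂ, ∃ c : ℂ, c ≠ 0 ∧ X = c • (A * ρ) ∧ IsOscillating H L A ρ ω := by
  obtain ⟨U, R, hU, hU', hR, rfl⟩ := exists_polar_decomposition X
  obtain ⟨h1, h2, h3⟩ := polar_of_eigen hH L hU hU' hR hX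
  have hR0 : R.trace ≠ 0 := fun h => hX0 (by rw [hR.trace_eq_zero_iff.1 h, mul_zero])
  refine ⟨U, R.trace⁻¹ • R, R.trace, hR0, ?_, ?_, ⟨⟨?_, ?_⟩, ?_⟩, ?_, ?_⟩
  · rw [Matrix.mul_smul, smul_smul, mul_inv_cancel₀ hR0, one_smul]
  · exact Matrix.mem_unitaryGroup_iff.2 hU'
  · exact hR.smul (inv_nonneg.2 hR.trace_nonneg)
  · rw [trace_smul, smul_eq_mul, inv_mul_cancel₀ hR0]
  · rw [map_smul, h1, smul_zero]
  · intro m; rw [Matrix.mul_smul, h2, smul_zero]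
  · rw [Matrix.mul_smul, Matrix.mul_smul, h3, smul_comm]

end Lindblad

/-! ### The spectrum of `ℒ` relative to the imaginary axis. -/

section Spectrum

variable {n μ : Type*} [Fintype n] [DecidableEq n] [Fintype μ]

/-- Take the trace of `(1 - V) R (1 - V)ᴴ ≥ 0`. This variational bound stands in for the triangle
inequality of the trace norm. -/
theorem re_trace_mul_le {V R : Matrix n n ℂ} (hV : Vᴴ * V = 1) (hR : R.PosSemidef) :
    (V * R).trace.re ≤ R.trace.re := by
  have h := (Complex.le_def.1 (hR.mul_mul_conjTranspose_same (1 - V)).trace_nonneg).1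
  have h1 : (R * Vᴴ).trace = star (V * R).trace := by
    rw [← trace_conjTranspose, conjTranspose_mul, hR.isHermitian.eq]
  have h2 : (V * R * Vᴴ).trace = R.trace := by rw [trace_mul_comm, ← mul_assoc, hV, one_mul]
  have h3 : (1 - V) * R * (1 - V)ᴴ = R - V * R - R * Vᴴ + V * R * Vᴴ := by
    rw [conjTranspose_sub, conjTranspose_one]; noncomm_ring
  rw [h3, trace_add, trace_sub, trace_sub, h1, h2] at h
  simp only [Complex.zero_re, Complex.add_re, Complex.sub_re, RCLike.star_def,
    Complex.conj_re] at h
  linarith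

theorem re_eigenvalue_nonpos {H : Matrix n n ℂ} (hH : H.IsHermitian) (L : μ → Matrix n n ℂ)
    {X : Matrix n n ℂ} {z : ℂ} (hX : liouvillian H L X = z • X) (hX0 : X ≠ 0) : z.re ≤ 0 := by
  obtain ⟨U, R, hU, hU', hR, rfl⟩ := exists_polar_decomposition X
  have h := re_trace_polar_nonpos hH L hU hU' hR
  rw [hX, Matrix.mul_smul, ← mul_assoc, hU, one_mul, trace_smul, smul_eq_mul] at h
  have h0 := Complex.le_def.1 hR.trace_nonneg
  have hne : R.trace ≠ 0 := fun h => hX0 (by rw [hR.trace_eq_zero_iff.1 h, mul_zero])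
  have hne' : R.trace.re ≠ 0 := fun h => hne (Complex.ext h h0.2.symm)
  have hpos : 0 < R.trace.re := lt_of_le_of_ne h0.1 (Ne.symm hne')
  rw [Complex.mul_re, ← h0.2, Complex.zero_im, mul_zero, sub_zero] at h
  exact nonpos_of_mul_nonpos_left h hpos

/-- Purely imaginary eigenvalues of `ℒ` have no Jordan blocks. -/
theorem semisimple_of_re_eq_zero {H : Matrix n n ℂ} (hH : H.IsHermitian) (L : μ → Matrix n n ℂ)
    {X Y : Matrix n n ℂ} {z : ℂ} (hz : z.re = 0) (hX : liouvillian H L X = z • X)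
    (hY : liouvillian H L Y = z • Y + X) : X = 0 := by
  obtain ⟨U₀, R₀, hU₀, hU₀', hR₀, hX₀⟩ := exists_polar_decomposition X
  obtain ⟨U₁, R₁, hU₁, hU₁', hR₁, hY₁⟩ := exists_polar_decomposition Y
  -- With `‖·‖₁` the trace norm, contractivity at `X + s Y` gives `‖X + s Y‖₁ ≤ s ‖Y‖₁`, while `‖X +
  -- s Y‖₁ ≥ ‖X‖₁ - s ‖Y‖₁`. Letting `s → 0` yields `X = 0`.
  have bound : ∀ s : ℝ, 0 < s → R₀.trace.re ≤ s * (2 * R₁.trace.re) := by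
    intro s hs
    obtain ⟨U, R, hU, hU', hR, hZ⟩ := exists_polar_decomposition (X + (s : ℂ) • Y)
    have h1 : R.trace.re ≤ s * (Uᴴ * Y).trace.re := by
      have h := re_trace_polar_nonpos hH L hU hU' hR
      have h2 : liouvillian H L (U * R) = (z + s) • (U * R) - ((s : ℂ) ^ 2) • Y := by
        rw [← hZ, map_add, map_smul, hX, hY]
        module
      rw [h2, mul_sub, Matrix.mul_smul, Matrix.mul_smul, ← mul_assoc, hU, one_mul, trace_sub,
        trace_smul, trace_smul, smul_eq_mul, smul_eq_mul, ← Complex.ofReal_pow, Complex.sub_re,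
        Complex.re_ofReal_mul, Complex.mul_re, ← (Complex.le_def.1 hR.trace_nonneg).2,
        Complex.add_re, hz, Complex.ofReal_re, Complex.zero_im, mul_zero, sub_zero, zero_add,
        sub_nonpos, pow_two, mul_assoc] at h
      exact le_of_mul_le_mul_left h hs
    have h2 : (Uᴴ * Y).trace.re ≤ R₁.trace.re := by
      rw [hY₁, ← mul_assoc]
      refine re_trace_mul_le ?_ hR₁
      rw [conjTranspose_mul, conjTranspose_conjTranspose, mul_assoc, ← mul_assoc U, hU', one_mul,
        hU₁]
    have h3 : -(U₀ᴴ * Y).trace.re ≤ R₁.trace.re := by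
      rw [hY₁, ← mul_assoc, ← Complex.neg_re, ← trace_neg, ← neg_mul]
      refine re_trace_mul_le ?_ hR₁
      rw [conjTranspose_neg, neg_mul_neg, conjTranspose_mul, conjTranspose_conjTranspose,
        mul_assoc, ← mul_assoc U₀, hU₀', one_mul, hU₁]
    have h4 : (U₀ᴴ * (X + (s : ℂ) • Y)).trace.re ≤ R.trace.re := by
      rw [hZ, ← mul_assoc]
      refine re_trace_mul_le ?_ hR
      rw [conjTranspose_mul, conjTranspose_conjTranspose, mul_assoc, ← mul_assoc U₀, hU₀',
        one_mul, hU]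
    rw [mul_add, hX₀, ← mul_assoc, hU₀, one_mul, Matrix.mul_smul, trace_add, trace_smul,
      smul_eq_mul, Complex.add_re, Complex.re_ofReal_mul] at h4
    nlinarith
  have h0 : R₀.trace.re ≤ 0 := by
    refine le_of_forall_pos_le_add fun ε hε => ?_
    have hr : 0 ≤ R₁.trace.re := (Complex.le_def.1 hR₁.trace_nonneg).1
    -- The `+ 1` keeps the denominator positive when `Y = 0`.
    refine (bound (ε / (2 * R₁.trace.re + 1)) (by positivity)).trans ?_
    rw [zero_add, div_mul_eq_mul_div, div_le_iff₀ (by positivity)]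
    nlinarith
  have h1 := Complex.le_def.1 hR₀.trace_nonneg
  rw [hX₀, hR₀.trace_eq_zero_iff.1 (Complex.ext (le_antisymm h0 h1.1) h1.2.symm), mul_zero]

theorem eigen_of_mem_maxGenEigenspace {H : Matrix n n ℂ} (hH : H.IsHermitian)
    (L : μ → Matrix n n ℂ) {X : Matrix n n ℂ} {z : ℂ} (hz : z.re = 0) {k : ℕ}
    (hX : ((liouvillian H L - z • (1 : Module.End ℂ (Matrix n n ℂ))) ^ k) X = 0) :
    liouvillian H L X = z • X := by
  induction k generalizing X with
  | zero =>
    have h0 : X = 0 := hX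
    rw [h0, map_zero, smul_zero]
  | succ k ih =>
    rw [pow_succ, Module.End.mul_apply] at hX
    have h1 := ih hX
    have h2 := semisimple_of_re_eq_zero hH L hz h1 (Y := X) (by
      rw [LinearMap.sub_apply, LinearMap.smul_apply, Module.End.one_apply]; abel)
    rw [LinearMap.sub_apply, LinearMap.smul_apply, Module.End.one_apply, sub_eq_zero] at h2
    exact h2

theorem re_nonpos_of_mem_maxGenEigenspace {H : Matrix n n ℂ} (hH : H.IsHermitian)
    (L : μ → Matrix n n ℂ) {X : Matrix n n ℂ} (hX0 : X ≠ 0) {z : ℂ} {k : ℕ}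
    (hX : ((liouvillian H L - z • (1 : Module.End ℂ (Matrix n n ℂ))) ^ k) X = 0) :
    z.re ≤ 0 := by
  induction k generalizing X with
  | zero => exact absurd hX hX0
  | succ k ih =>
    rw [pow_succ, Module.End.mul_apply] at hX
    by_cases h : (liouvillian H L - z • (1 : Module.End ℂ (Matrix n n ℂ))) X = 0
    · rw [LinearMap.sub_apply, LinearMap.smul_apply, Module.End.one_apply, sub_eq_zero] at h
      exact re_eigenvalue_nonpos hH L h hX0
    · exact ih h hX

end Spectrum

/-! ### Exponential flow of an endomorphism. -/

section Flow

variable {V : Type*} [NormedAddCommGroup V] [NormedSpace ℂ V] [FiniteDimensional ℂ V]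

/-- The flow `e^{tG} x` of an endomorphism of a finite-dimensional normed space. -/
def linearFlow (G : Module.End ℂ V) (t : ℝ) (x : V) : V :=
  NormedSpace.exp ((t : ℂ) • LinearMap.toContinuousLinearMap G) x

theorem hasSum_linearFlow (G : Module.End ℂ V) (t : ℝ) (x : V) :
    HasSum (fun k : ℕ => ((k.factorial : ℂ)⁻¹ * (t : ℂ) ^ k) • (G ^ k) x)
      (linearFlow G t x) := by
  have := FiniteDimensional.complete ℂ V
  have h := NormedSpace.exp_series_hasSum_exp' (𝕂 := ℂ)
    ((t : ℂ) • LinearMap.toContinuousLinearMap G)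
  have h2 := h.mapL (ContinuousLinearMap.apply ℂ V x)
  have hpow : ∀ (k : ℕ) (y : V), (LinearMap.toContinuousLinearMap G ^ k) y = (G ^ k) y := by
    intro k
    induction k with
    | zero => exact fun y => rfl
    | succ k ih => intro y; rw [pow_succ, pow_succ]; exact ih (G y)
  convert h2 using 2 with k
  · rw [smul_pow, smul_smul, ← hpow]
    rfl
  · rfl

theorem map_linearFlow (T : V →ₗ[ℂ] V) {G : Module.End ℂ V} (hT : ∀ x, T (G x) = G (T x))
    (t : ℝ) (x : V) : T (linearFlow G t x) = linearFlow G t (T x) := by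
  have hpow : ∀ (k : ℕ) (x : V), T ((G ^ k) x) = (G ^ k) (T x) := by
    intro k
    induction k with
    | zero => exact fun _ => rfl
    | succ k ih =>
      intro x
      rw [pow_succ, Module.End.mul_apply, Module.End.mul_apply, ih, hT]
  have h := (hasSum_linearFlow G t x).mapL (LinearMap.toContinuousLinearMap T)
  refine h.unique ?_
  convert hasSum_linearFlow G t (T x) using 2 with k
  rw [LinearMap.coe_toContinuousLinearMap', map_smul, hpow]

theorem hasDerivAt_linearFlow (G : Module.End ℂ V) (x : V) (t : ℝ) :
    HasDerivAt (fun s => linearFlow G s x) (linearFlow G t (G x)) t := by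
  have := FiniteDimensional.complete ℂ V
  have h := hasDerivAt_exp_smul_const (𝕂 := ℂ) (LinearMap.toContinuousLinearMap G) (t : ℂ)
  have h2 := ((ContinuousLinearMap.apply ℂ V x).hasFDerivAt.comp_hasDerivAt _ h)
  have h3 := h2.scomp t Complex.ofRealCLM.hasDerivAt
  rw [Complex.ofRealCLM_apply, Complex.ofReal_one, one_smul] at h3
  exact h3

theorem linearFlow_eq_exp_smul_linearFlow_sub (G : Module.End ℂ V) (z : ℂ) (t : ℝ) (x : V) :
    linearFlow G t x = Complex.exp (z * t) • linearFlow (G - z • (1 : Module.End ℂ V)) t x := by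
  have := FiniteDimensional.complete ℂ V
  have h1 : (t : ℂ) • LinearMap.toContinuousLinearMap G =
      algebraMap ℂ (V →L[ℂ] V) (z * t) +
      (t : ℂ) • LinearMap.toContinuousLinearMap (G - z • (1 : Module.End ℂ V)) := by
    ext1 y
    change (t : ℂ) • G y = (z * t) • y + (t : ℂ) • (G y - z • y)
    module
  have h2 : NormedSpace.exp (algebraMap ℂ (V →L[ℂ] V) (z * t)) =
      algebraMap ℂ (V →L[ℂ] V) (Complex.exp (z * t)) := by
    rw [Complex.exp_eq_exp_ℂ]
    exact (NormedSpace.algebraMap_exp_comm (z * (t : ℂ))).symm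
  let : NormedAlgebra ℚ (V →L[ℂ] V) := .restrictScalars ℚ ℂ (V →L[ℂ] V)
  rw [linearFlow, h1, NormedSpace.exp_add_of_commute (Algebra.commute_algebraMap_left _ _), h2]
  rfl

theorem linearFlow_eq_sum_of_pow_eq_zero (N : Module.End ℂ (V)) (t : ℝ) (x : V)
    {k : ℕ} (hx : (N ^ k) x = 0) :
    linearFlow N t x = ∑ i ∈ Finset.range k, ((i.factorial : ℂ)⁻¹ * (t : ℂ) ^ i) • (N ^ i) x := by
  refine (hasSum_linearFlow N t x).unique (hasSum_sum_of_ne_finset_zero fun i hi => ?_)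
  rw [Finset.mem_range, not_lt] at hi
  obtain ⟨m, rfl⟩ := Nat.exists_eq_add_of_le' hi
  rw [pow_add N, Module.End.mul_apply, hx, map_zero, smul_zero]

theorem linearFlow_eigen {G : Module.End ℂ V} {z : ℂ} {x : V}
    (h : G x = z • x) (t : ℝ) : linearFlow G t x = Complex.exp (z * t) • x := by
  rw [linearFlow_eq_exp_smul_linearFlow_sub G z, linearFlow_eq_sum_of_pow_eq_zero _ t x (k := 1)]
  · simp
  · rw [pow_one, LinearMap.sub_apply, LinearMap.smul_apply, Module.End.one_apply, h, sub_self]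

theorem linearFlow_decay {G : Module.End ℂ (V)} {z : ℂ} (hz : z.re < 0)
    {x : V} {k : ℕ} (hx : ((G - z • (1 : Module.End ℂ (V))) ^ k) x = 0) :
    EventuallyEq (fun t => linearFlow G t x) fun _ => 0 := by
  set N := G - z • (1 : Module.End ℂ (V))
  -- Half of the decay rate is spent on the polynomial factor, through `t ^ i / i! ≤ γ ^ (-i) e^{γ
  -- t}`; the other half remains.
  set γ := -z.re / 2 with hγ
  have hγ0 : 0 < γ := by rw [hγ]; linarith
  refine ⟨0, ∑ i ∈ Finset.range k, (γ ^ i)⁻¹ * ‖(N ^ i) x‖, γ, hγ0, fun t ht => ?_⟩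
  have hexp : Real.exp (z.re * t) * Real.exp (γ * t) = Real.exp (-γ * t) := by
    rw [← Real.exp_add]; congr 1; rw [hγ]; ring
  change ‖linearFlow G t x - 0‖ ≤ _
  rw [sub_zero, linearFlow_eq_exp_smul_linearFlow_sub G z, linearFlow_eq_sum_of_pow_eq_zero N t x hx, norm_smul,
    Complex.norm_exp, Complex.re_mul_ofReal, ← hexp, mul_comm, mul_comm (Real.exp _), ← mul_assoc]
  refine mul_le_mul_of_nonneg_right ?_ (Real.exp_pos _).le
  rw [Finset.sum_mul]
  refine norm_sum_le_of_le _ fun i _ => ?_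
  have hb := Real.pow_div_factorial_le_exp _ (mul_nonneg hγ0.le ht) i
  rw [norm_smul, norm_mul, norm_inv, norm_pow, Complex.norm_real, Real.norm_of_nonneg ht,
    Complex.norm_natCast, mul_right_comm _ ‖(N ^ i) x‖]
  refine mul_le_mul_of_nonneg_right ?_ (norm_nonneg _)
  rw [inv_mul_eq_div ((γ : ℝ) ^ i), le_div_iff₀ (pow_pos hγ0 i)]
  refine le_trans (le_of_eq ?_) hb
  rw [mul_pow]; ring

end Flow

/-! ### Signals up to exponentially small terms. -/

section Signals

variable {V W : Type*} [NormedAddCommGroup V] [NormedAddCommGroup W]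

theorem EventuallyEq.refl (f : ℝ → V) : EventuallyEq f f :=
  ⟨0, 0, 1, one_pos, fun t _ => by simp⟩

theorem EventuallyEq.add {f g f' g' : ℝ → V} (h : EventuallyEq f g) (h' : EventuallyEq f' g') :
    EventuallyEq (fun t => f t + f' t) fun t => g t + g' t := by
  obtain ⟨τ, C, γ, hγ, h⟩ := h
  obtain ⟨τ', C', γ', hγ', h'⟩ := h'
  -- Passing to the smaller rate enlarges the exponential only for `t ≥ 0`, and the constants are
  -- not assumed nonnegative.
  refine ⟨max 0 (max τ τ'), |C| + |C'|, min γ γ', lt_min hγ hγ', fun t ht => ?_⟩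
  rw [max_le_iff, max_le_iff] at ht
  obtain ⟨ht0, htτ, htτ'⟩ := ht
  have e1 : Real.exp (-γ * t) ≤ Real.exp (-min γ γ' * t) :=
    Real.exp_le_exp.2 (mul_le_mul_of_nonneg_right (neg_le_neg (min_le_left _ _)) ht0)
  have e2 : Real.exp (-γ' * t) ≤ Real.exp (-min γ γ' * t) :=
    Real.exp_le_exp.2 (mul_le_mul_of_nonneg_right (neg_le_neg (min_le_right _ _)) ht0)
  calc ‖f t + f' t - (g t + g' t)‖ ≤ ‖f t - g t‖ + ‖f' t - g' t‖ := by
        rw [add_sub_add_comm]; exact norm_add_le _ _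
    _ ≤ C * Real.exp (-γ * t) + C' * Real.exp (-γ' * t) := add_le_add (h t htτ) (h' t htτ')
    _ ≤ |C| * Real.exp (-min γ γ' * t) + |C'| * Real.exp (-min γ γ' * t) :=
        add_le_add (mul_le_mul (le_abs_self _) e1 (Real.exp_pos _).le (abs_nonneg _))
          (mul_le_mul (le_abs_self _) e2 (Real.exp_pos _).le (abs_nonneg _))
    _ = _ := by ring

theorem EventuallyEq.sum {α : Type*} (s : Finset α) {f : α → ℝ → V}
    (h : ∀ i ∈ s, EventuallyEq (f i) fun _ => 0) :
    EventuallyEq (fun t => ∑ i ∈ s, f i t) fun _ => 0 := by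
  classical
  induction s using Finset.induction_on with
  | empty => simpa using EventuallyEq.refl (fun _ => (0 : V))
  | insert i s hi ih =>
    have := (h i (Finset.mem_insert_self i s)).add
      (ih fun j hj => h j (Finset.mem_insert_of_mem hj))
    simpa only [Finset.sum_insert hi, add_zero] using this

theorem EventuallyEq.map [NormedSpace ℝ V] [NormedSpace ℝ W] {f g : ℝ → V} (h : EventuallyEq f g) (T : V →L[ℝ] W) :
    EventuallyEq (fun t => T (f t)) fun t => T (g t) := by
  obtain ⟨τ, C, γ, hγ, h⟩ := h
  refine ⟨τ, ‖T‖ * C, γ, hγ, fun t ht => ?_⟩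
  rw [← map_sub, mul_assoc]
  exact (T.le_opNorm _).trans (mul_le_mul_of_nonneg_left (h t ht) (norm_nonneg _))

theorem eventuallyEq_of_sub {f g : ℝ → V} (h : EventuallyEq (fun t => f t - g t) fun _ => 0) :
    EventuallyEq f g := by
  obtain ⟨τ, C, γ, hγ, h⟩ := h
  exact ⟨τ, C, γ, hγ, fun t ht => by simpa using h t ht⟩

theorem EventuallyEq.tendsto {f : ℝ → V} {c : V} (h : EventuallyEq f fun _ => c) :
    Filter.Tendsto f Filter.atTop (nhds c) := by
  obtain ⟨τ, C, γ, hγ, h⟩ := h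
  rw [tendsto_iff_norm_sub_tendsto_zero]
  refine squeeze_zero' (Filter.Eventually.of_forall fun t => norm_nonneg _)
    ((Filter.eventually_ge_atTop τ).mono h) ?_
  rw [← mul_zero C]
  refine Filter.Tendsto.const_mul C (Real.tendsto_exp_atBot.comp ?_)
  exact Filter.tendsto_id.const_mul_atTop_of_neg (neg_lt_zero.2 hγ)

theorem periodic_eq_of_tendsto {f : ℝ → V} {T : ℝ} (hT : 0 < T)
    (hf : Function.Periodic f T) {c : V} (h : Filter.Tendsto f Filter.atTop (nhds c)) (t : ℝ) :
    f t = c := by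
  have h1 : Filter.Tendsto (fun m : ℕ => t + m * T) Filter.atTop Filter.atTop :=
    Filter.tendsto_atTop_add_const_left _ _
      (tendsto_natCast_atTop_atTop.atTop_mul_const hT)
  have h2 : (f ∘ fun m : ℕ => t + m * T) = fun _ => f t := by
    ext m
    exact hf.nat_mul m t
  exact tendsto_nhds_unique tendsto_const_nhds (h2 ▸ h.comp h1)

/-- A signal with a nonzero component at a nonzero frequency does not become constant. -/
theorem not_eventuallyEq_const_of_oscillating {ω : ℝ} (hω : ω ≠ 0) (a : ℂ) {b : ℂ} (hb : b ≠ 0)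
    (b' c : ℂ) :
    ¬ EventuallyEq (fun t : ℝ => a + b * Complex.exp (Complex.I * ω * t) +
      b' * Complex.exp (-(Complex.I * ω) * t)) fun _ => c := by
  intro h
  have hω' : (ω : ℂ) ≠ 0 := Complex.ofReal_ne_zero.2 hω
  have hper : Function.Periodic (fun t : ℝ => a + b * Complex.exp (Complex.I * ω * t) +
      b' * Complex.exp (-(Complex.I * ω) * t)) (2 * Real.pi / |ω|) := by
    have key : Complex.exp (Complex.I * ω * (2 * Real.pi / |ω| : ℝ)) = 1 := by
      rcases abs_choice ω with hs | hs
      · rw [hs, Complex.exp_eq_one_iff]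
        refine ⟨1, ?_⟩
        push_cast
        field_simp
      · rw [hs, Complex.exp_eq_one_iff]
        refine ⟨-1, ?_⟩
        push_cast
        field_simp
    intro t
    simp only [Complex.ofReal_add, mul_add, Complex.exp_add, neg_mul, Complex.exp_neg, key,
      mul_one, inv_one]
  have hc := periodic_eq_of_tendsto (by positivity) hper h.tendsto
  -- A convergent periodic signal is constant. Sampling it at phases `0`, `π` and `π / 2` gives `b +
  -- b' = 0` and `b - b' = 0`.
  have h0 := hc 0
  have h1 := hc (Real.pi / ω)
  have h2 := hc (Real.pi / 2 / ω)
  have e1 : Complex.I * ω * (Real.pi / ω : ℝ) = Real.pi * Complex.I := by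
    push_cast; field_simp
  have e2 : Complex.I * ω * (Real.pi / 2 / ω : ℝ) = Real.pi / 2 * Complex.I := by
    push_cast; field_simp
  simp only [Complex.ofReal_zero, mul_zero, Complex.exp_zero, mul_one] at h0
  simp only [neg_mul, e1, Complex.exp_neg, Complex.exp_pi_mul_I] at h1
  simp only [neg_mul, e2, Complex.exp_neg, Complex.exp_pi_div_two_mul_I, Complex.inv_I] at h2
  apply hb
  have h3 : b + b' = 0 := by
    have : (-1 : ℂ)⁻¹ = -1 := by norm_num
    rw [this] at h1
    linear_combination (h0 - h1) / 2
  have h4 : Complex.I * (b - b') = 0 := by linear_combination h2 - h0 + h3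
  have h5 := (mul_eq_zero.1 h4).resolve_left Complex.I_ne_zero
  linear_combination (h3 + h5) / 2

end Signals

/-! ### Decay of observables orthogonal to the oscillating modes. -/

section Flow

variable {n μ : Type*} [Fintype n] [DecidableEq n] [Fintype μ]

theorem trace_mul_flow_liouvillian (H : Matrix n n ℂ) (L : μ → Matrix n n ℂ)
    (B X : Matrix n n ℂ) (t : ℝ) :
    (B * flow (liouvillian H L) t X).trace = (flow (adjointLiouvillian H L) t B * X).trace := by
  have hpow : ∀ (k : ℕ) (B X : Matrix n n ℂ),
      (B * ((liouvillian H L : Module.End ℂ (Matrix n n ℂ)) ^ k) X).trace =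
      (((adjointLiouvillian H L : Module.End ℂ (Matrix n n ℂ)) ^ k) B * X).trace := by
    intro k
    induction k with
    | zero => exact fun _ _ => rfl
    | succ k ih =>
      intro B X
      rw [pow_succ', pow_succ, Module.End.mul_apply, Module.End.mul_apply, trace_mul_liouvillian,
        ih]
  have h1 := (hasSum_linearFlow (liouvillian H L) t X).mapL
    (LinearMap.toContinuousLinearMap (traceLinearMap n ℂ ℂ ∘ₗ LinearMap.mulLeft ℂ B))
  have h2 := (hasSum_linearFlow (adjointLiouvillian H L) t B).mapL
    (LinearMap.toContinuousLinearMap (traceLinearMap n ℂ ℂ ∘ₗ LinearMap.mulRight ℂ X))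
  refine h1.unique ?_
  convert h2 using 2 with k
  · simp [hpow]
  · rfl

/-- An operator orthogonal to all purely imaginary eigenmatrices of `ℒ` has decaying
expectation. -/
theorem trace_mul_flow_decay {H : Matrix n n ℂ} (hH : H.IsHermitian) (L : μ → Matrix n n ℂ)
    {D : Matrix n n ℂ}
    (hD : ∀ (ω : ℝ) (X : Matrix n n ℂ), liouvillian H L X = (Complex.I * (ω : ℂ)) • X →
      (D * X).trace = 0) (Y : Matrix n n ℂ) :
    EventuallyEq (fun t => (D * flow (liouvillian H L) t Y).trace) fun _ => 0 := by
  have hY : Y ∈ ⨆ z : ℂ, Module.End.maxGenEigenspace (liouvillian H L) z := by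
    rw [Module.End.iSup_maxGenEigenspace_eq_top]; trivial
  induction hY using Submodule.iSup_induction' with
  | mem z X hX =>
    -- Off the axis the generalized eigenvector itself decays; on the axis it is a genuine
    -- eigenvector, which `hD` makes invisible to `D`.
    obtain ⟨k, hk⟩ := (Module.End.mem_maxGenEigenspace _ _ _).1 hX
    by_cases hX0 : X = 0
    · have : (fun t => (D * flow (liouvillian H L) t X).trace) = fun _ => 0 := by
        ext t; rw [hX0, flow, map_zero, mul_zero, trace_zero]
      rw [this]
      exact EventuallyEq.refl _
    rcases (re_nonpos_of_mem_maxGenEigenspace hH L hX0 hk).lt_or_eq with hz | hz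
    · have := (linearFlow_decay hz hk).map ((LinearMap.toContinuousLinearMap
        (traceLinearMap n ℂ ℂ ∘ₗ LinearMap.mulLeft ℂ D)).restrictScalars ℝ)
      rw [map_zero] at this
      exact this
    · have hE := eigen_of_mem_maxGenEigenspace hH L hz hk
      have hz' : z = Complex.I * (z.im : ℂ) := by
        apply Complex.ext <;> simp [hz]
      have : (fun t => (D * flow (liouvillian H L) t X).trace) = fun _ => 0 := by
        ext t
        have hf : flow (liouvillian H L) t X = _ := linearFlow_eigen hE t
        rw [hf, Matrix.mul_smul, trace_smul, hD z.im X (by rw [← hz']; exact hE), smul_zero]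
      rw [this]
      exact EventuallyEq.refl _
  | zero =>
    have : (fun t => (D * flow (liouvillian H L) t 0).trace) = fun _ => 0 := by
      ext t; rw [flow, map_zero, mul_zero, trace_zero]
    rw [this]
    exact EventuallyEq.refl _
  | add X Y _ _ hX hY =>
    have := hX.add hY
    simp only [add_zero, ← trace_add, ← mul_add] at this
    simpa only [flow, map_add] using this

theorem flow_adjointLiouvillian_decay {H : Matrix n n ℂ} (hH : H.IsHermitian)
    (L : μ → Matrix n n ℂ) {D : Matrix n n ℂ}
    (hD : ∀ (ω : ℝ) (X : Matrix n n ℂ), liouvillian H L X = (Complex.I * (ω : ℂ)) • X →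
      (D * X).trace = 0) :
    EventuallyEq (fun t => flow (adjointLiouvillian H L) t D) fun _ => 0 := by
  -- The `(i, j)` entry of the evolved `D` is its trace pairing with the matrix unit `(j, i)`, which
  -- reduces operator decay to scalar decay.
  have hsum : (fun t => flow (adjointLiouvillian H L) t D) = fun t =>
      ∑ i, ∑ j, (D * flow (liouvillian H L) t (single j i 1)).trace • single i j (1 : ℂ) := by
    ext1 t
    conv_lhs => rw [matrix_eq_sum_single (flow (adjointLiouvillian H L) t D)]
    refine Finset.sum_congr rfl fun i _ => Finset.sum_congr rfl fun j _ => ?_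
    rw [trace_mul_flow_liouvillian, trace_mul_single, smul_single]
    simp
  rw [hsum]
  refine EventuallyEq.sum _ fun i _ => EventuallyEq.sum _ fun j _ => ?_
  have := (trace_mul_flow_decay hH L hD (single j i 1)).map
    ((ContinuousLinearMap.toSpanSingleton ℂ (single i j (1 : ℂ))).restrictScalars ℝ)
  rw [map_zero] at this
  exact this

end Flow

/-! ### Invariance of the oscillating modes under a weak symmetry. -/

section Symmetry

variable {n μ : Type*} [Fintype n] [DecidableEq n] [Fintype μ]

/-- If the oscillating `A` commute with a weak symmetry `P` on the range of `ρ∞`, then every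
purely imaginary eigenmatrix of `ℒ` is `P`-invariant. -/
theorem conj_eq_self_of_eigen {H : Matrix n n ℂ} (hH : H.IsHermitian) (L : μ → Matrix n n ℂ)
    {P : Matrix n n ℂ} (hPP : P * P = 1) (hw : IsWeakSymmetry H L P)
    (hcomm : ∀ A ρ ω, IsOscillating H L A ρ ω → (P * A - A * P) * ρ = 0)
    {X : Matrix n n ℂ} {ω : ℝ} (hX : liouvillian H L X = (Complex.I * (ω : ℂ)) • X) :
    P * X * P = X := by
  have hPA : ∀ {A ρ : Matrix n n ℂ} {ω : ℝ}, IsOscillating H L A ρ ω →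
      P * (A * ρ) * P = A * (P * ρ * P) := fun {A ρ ω} h => by
    have := hcomm A ρ ω h
    rw [sub_mul, sub_eq_zero, mul_assoc, mul_assoc] at this
    rw [this]
    simp only [mul_assoc]
  have hness : ∀ {ρ : Matrix n n ℂ}, liouvillian H L ρ = 0 → P * ρ * P = ρ := fun {ρ} hρ => by
    have hPD : P * (ρ - P * ρ * P) * P = -(ρ - P * ρ * P) := by
      have : P * (P * ρ * P) * P = (P * P) * ρ * (P * P) := by simp only [mul_assoc]
      rw [mul_sub, sub_mul, this, hPP, one_mul, mul_one, neg_sub]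
    have hD : liouvillian H L (ρ - P * ρ * P) =
        (Complex.I * ((0 : ℝ) : ℂ)) • (ρ - P * ρ * P) := by
      rw [map_sub, hw, hρ]
      simp
    by_contra hne
    have hD0 : ρ - P * ρ * P ≠ 0 := fun h => hne (sub_eq_zero.1 h).symm
    -- The `P`-odd part of `ρ` is stationary, so the commutation hypothesis is used here at
    -- frequency `0`. It turns oddness of `A σ` into `P σ P = -σ`, and the trace then reads `1 =
    -- -1`.
    obtain ⟨A, σ, c, hc, hDA, hA⟩ := exists_isOscillating hH L hD hD0
    rw [hDA, Matrix.mul_smul, Matrix.smul_mul, hPA hA, ← smul_neg] at hPD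
    have h1 := smul_right_injective _ hc hPD
    have hAA : Aᴴ * A = 1 := Matrix.mem_unitaryGroup_iff'.1 hA.unitary
    have h2 : P * σ * P = -σ := by
      have := congrArg (Aᴴ * ·) h1
      simpa only [mul_neg, ← mul_assoc, hAA, one_mul] using this
    have h3 := congrArg trace h2
    rw [trace_mul_comm, ← mul_assoc, hPP, one_mul, trace_neg, hA.ness.1.2] at h3
    norm_num at h3
  by_cases hX0 : X = 0
  · rw [hX0, mul_zero, zero_mul]
  obtain ⟨A, σ, c, hc, rfl, hA⟩ := exists_isOscillating hH L hX hX0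
  rw [Matrix.mul_smul, Matrix.smul_mul, hPA hA, hness hA.ness.2]

theorem adjointLiouvillian_conj {H : Matrix n n ℂ} (L : μ → Matrix n n ℂ)
    {P : Matrix n n ℂ} (hw : IsWeakSymmetry H L P) (B : Matrix n n ℂ) :
    adjointLiouvillian H L (P * B * P) = P * adjointLiouvillian H L B * P := by
  refine Matrix.ext_iff_trace_mul_right.2 fun X => ?_
  have hcyc : ∀ Y Z : Matrix n n ℂ, (P * Y * P * Z).trace = (Y * (P * Z * P)).trace :=
    fun Y Z => by
      rw [mul_assoc, mul_assoc, trace_mul_comm]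
      simp only [mul_assoc]
  rw [hcyc, ← trace_mul_liouvillian, ← trace_mul_liouvillian, hcyc, hw]

theorem flow_adjointLiouvillian_conj {H : Matrix n n ℂ} (L : μ → Matrix n n ℂ)
    {P : Matrix n n ℂ} (hw : IsWeakSymmetry H L P) (B : Matrix n n ℂ) (t : ℝ) :
    flow (adjointLiouvillian H L) t (P * B * P) = P * flow (adjointLiouvillian H L) t B * P :=
  (map_linearFlow (LinearMap.mulRight ℂ P ∘ₗ LinearMap.mulLeft ℂ P)
    (fun B => (adjointLiouvillian_conj L hw B).symm) t B).symm

end Symmetry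

/-! ### Persistent oscillations. -/

section Nonstationary

variable {n μ : Type*} [Fintype n] [DecidableEq n] [Fintype μ]

theorem hasDerivAt_expectation (H : Matrix n n ℂ) (L : μ → Matrix n n ℂ)
    (B ρ : Matrix n n ℂ) (t : ℝ) :
    HasDerivAt (expectation H L B ρ) (expectation H L B (liouvillian H L ρ) t) t :=
  ((LinearMap.toContinuousLinearMap
    (traceLinearMap n ℂ ℂ ∘ₗ LinearMap.mulLeft ℂ B)).restrictScalars ℝ).hasFDerivAt.comp_hasDerivAt
    t (hasDerivAt_linearFlow (liouvillian H L) ρ t)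

theorem hasDerivAt_heisenberg (H : Matrix n n ℂ) (L : μ → Matrix n n ℂ)
    (B : Matrix n n ℂ) (t : ℝ) :
    HasDerivAt (heisenberg H L B) (heisenberg H L (adjointLiouvillian H L B) t) t :=
  hasDerivAt_linearFlow (adjointLiouvillian H L) B t

theorem expectation_add (H : Matrix n n ℂ) (L : μ → Matrix n n ℂ) (B X Y : Matrix n n ℂ)
    (t : ℝ) :
    expectation H L B (X + Y) t = expectation H L B X t + expectation H L B Y t := by
  simp only [expectation, flow, map_add, mul_add, trace_add]

theorem expectation_smul (H : Matrix n n ℂ) (L : μ → Matrix n n ℂ) (B X : Matrix n n ℂ)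
    (c : ℂ) (t : ℝ) :
    expectation H L B (c • X) t = c * expectation H L B X t := by
  simp only [expectation, flow, map_smul, Matrix.mul_smul, trace_smul, smul_eq_mul]

theorem expectation_eigen {H : Matrix n n ℂ} {L : μ → Matrix n n ℂ} (B : Matrix n n ℂ)
    {X : Matrix n n ℂ} {z : ℂ} (hX : liouvillian H L X = z • X) (t : ℝ) :
    expectation H L B X t = (B * X).trace * Complex.exp (z * t) := by
  have hf : flow (liouvillian H L) t X = _ := linearFlow_eigen hX t
  rw [expectation, hf, Matrix.mul_smul, trace_smul, smul_eq_mul, mul_comm]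

theorem liouvillian_conjTranspose_eigen {H : Matrix n n ℂ} (hH : H.IsHermitian)
    {L : μ → Matrix n n ℂ} {X : Matrix n n ℂ} {ω : ℝ}
    (hX : liouvillian H L X = (Complex.I * (ω : ℂ)) • X) :
    liouvillian H L Xᴴ = (-(Complex.I * (ω : ℂ))) • Xᴴ := by
  rw [liouvillian_conjTranspose hH, hX, conjTranspose_smul]
  simp

/-- In `liouvillian_unitary_identity` the right side vanishes by `[L_μ, A] ρ = 0`, and the two mixed
terms `∓iω ρ` cancel. -/
theorem IsOscillating.liouvillian_conj {H : Matrix n n ℂ} (hH : H.IsHermitian)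
    {L : μ → Matrix n n ℂ} {A ρ : Matrix n n ℂ} {ω : ℝ} (h : IsOscillating H L A ρ ω) :
    liouvillian H L (A * ρ * Aᴴ) = 0 := by
  have hA : Aᴴ * A = 1 := Matrix.mem_unitaryGroup_iff'.1 h.unitary
  have hA' : A * Aᴴ = 1 := Matrix.mem_unitaryGroup_iff.1 h.unitary
  have hρA : ρ * Aᴴ = (A * ρ)ᴴ := by
    rw [conjTranspose_mul, h.ness.1.1.isHermitian.eq]
  have hC : ∀ m, (Aᴴ * L m * A - L m) * ρ = 0 := fun m => by
    have := congrArg (Aᴴ * ·) (h.comm m)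
    simp only [mul_zero, ← mul_assoc, mul_sub, hA, one_mul] at this
    exact this
  have hid := liouvillian_unitary_identity H L hA ρ
  rw [hρA, liouvillian_conjTranspose_eigen hH h.liouvillian_eq, h.liouvillian_eq, h.ness.2,
    ← hρA, add_zero, Finset.sum_eq_zero fun m _ => by rw [hC, zero_mul, smul_zero],
    Matrix.mul_smul, Matrix.smul_mul, mul_assoc ρ, hA, ← mul_assoc Aᴴ A, hA, one_mul, mul_one,
    neg_smul, sub_neg_eq_add, sub_add_cancel] at hid
  have := congrArg (fun Z => A * Z * Aᴴ) hid
  simp only [mul_assoc, hA', mul_zero, mul_one, zero_mul] at this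
  rw [← mul_assoc, ← mul_assoc A, hA', one_mul] at this
  exact this

/-- `A ρ` is traceless and so not a state. The witness `½ (1 + A) ρ (1 + A)ᴴ` is positive, and it
expands into the stationary `ρ + A ρ Aᴴ` and the modes `A ρ`, `(A ρ)ᴴ` at frequencies `±ω`. -/
theorem exists_isNonstationary_expectation {H : Matrix n n ℂ} (hH : H.IsHermitian)
    {L : μ → Matrix n n ℂ} {A ρ : Matrix n n ℂ} {ω : ℝ} (h : IsOscillating H L A ρ ω)
    (hω : ω ≠ 0) {B : Matrix n n ℂ} (hB : (B * (A * ρ)).trace ≠ 0) :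
    ∃ ρ₀, IsDensity ρ₀ ∧ IsNonstationary (expectation H L B ρ₀) := by
  have hω' : Complex.I * (ω : ℂ) ≠ 0 :=
    mul_ne_zero Complex.I_ne_zero (Complex.ofReal_ne_zero.2 hω)
  have hX := h.liouvillian_eq
  have hX' := liouvillian_conjTranspose_eigen hH hX
  have htr : (A * ρ).trace = 0 := by
    have := congrArg trace hX
    rw [trace_liouvillian, trace_smul, smul_eq_mul] at this
    exact (mul_eq_zero.1 this.symm).resolve_left hω'
  set Z := ρ + A * ρ * Aᴴ with hZdef
  have hZ : liouvillian H L Z = (0 : ℂ) • Z := by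
    rw [zero_smul, hZdef, map_add, h.ness.2, h.liouvillian_conj hH, zero_add]
  set σ := (2⁻¹ : ℂ) • (Z + A * ρ + (A * ρ)ᴴ) with hσdef
  have hσ : σ = (2⁻¹ : ℂ) • ((1 + A) * ρ * (1 + A)ᴴ) := by
    rw [hσdef, hZdef, conjTranspose_mul, h.ness.1.1.isHermitian.eq, conjTranspose_add,
      conjTranspose_one]
    congr 1
    noncomm_ring
  have hE : ∀ t, expectation H L B σ t = 2⁻¹ * (B * Z).trace +
      2⁻¹ * (B * (A * ρ)).trace * Complex.exp (Complex.I * ω * t) +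
      2⁻¹ * (B * (A * ρ)ᴴ).trace * Complex.exp (-(Complex.I * ω) * t) := fun t => by
    rw [hσdef, expectation_smul, expectation_add, expectation_add, expectation_eigen B hZ,
      expectation_eigen B hX, expectation_eigen B hX', zero_mul, Complex.exp_zero]
    ring
  have hLσ : liouvillian H L σ = (2⁻¹ : ℂ) • ((Complex.I * (ω : ℂ)) • (A * ρ) +
      (-(Complex.I * (ω : ℂ))) • (A * ρ)ᴴ) := by
    rw [hσdef, map_smul, map_add, map_add, hZ, hX, hX', zero_smul, zero_add]
  have hE' : ∀ t, deriv (expectation H L B σ) t = 0 +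
      2⁻¹ * (Complex.I * ω) * (B * (A * ρ)).trace * Complex.exp (Complex.I * ω * t) +
      -(2⁻¹ * (Complex.I * ω) * (B * (A * ρ)ᴴ).trace) *
        Complex.exp (-(Complex.I * ω) * t) := fun t => by
    rw [(hasDerivAt_expectation H L B σ t).deriv, hLσ, expectation_smul, expectation_add,
      expectation_smul, expectation_smul, expectation_eigen B hX, expectation_eigen B hX']
    ring
  refine ⟨σ, ⟨?_, ?_⟩, fun c => ?_, ?_⟩
  · rw [hσ]
    exact (h.ness.1.1.mul_mul_conjTranspose_same _).smul (by
      rw [Complex.le_def]; norm_num)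
  · have hA : Aᴴ * A = 1 := Matrix.mem_unitaryGroup_iff'.1 h.unitary
    rw [hσdef, trace_smul, trace_add, trace_add, trace_conjTranspose, htr, hZdef, trace_add,
      trace_mul_comm, ← mul_assoc, hA, one_mul, h.ness.1.2]
    norm_num
  · rw [funext hE]
    exact not_eventuallyEq_const_of_oscillating hω _ (mul_ne_zero (by norm_num) hB) _ c
  · rw [funext hE']
    exact not_eventuallyEq_const_of_oscillating hω _
      (mul_ne_zero (mul_ne_zero (by norm_num) hω') hB) _ 0

/-- Pairing with `X` is continuous and turns the operator signal into the pure exponential `tr (B X)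
e^{iωt}`; its derivative only gains the factor `iω`. -/
theorem isNonstationary_heisenberg {H : Matrix n n ℂ} {L : μ → Matrix n n ℂ}
    {X : Matrix n n ℂ} {ω : ℝ} (hX : liouvillian H L X = (Complex.I * (ω : ℂ)) • X)
    (hω : ω ≠ 0) {B : Matrix n n ℂ} (hB : (B * X).trace ≠ 0) :
    IsNonstationary (heisenberg H L B) := by
  have hω' : Complex.I * (ω : ℂ) ≠ 0 :=
    mul_ne_zero Complex.I_ne_zero (Complex.ofReal_ne_zero.2 hω)
  let T : Matrix n n ℂ →L[ℝ] ℂ := (LinearMap.toContinuousLinearMap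
    (traceLinearMap n ℂ ℂ ∘ₗ LinearMap.mulRight ℂ X)).restrictScalars ℝ
  have hT : ∀ (C : Matrix n n ℂ) (t : ℝ), T (heisenberg H L C t) =
      0 + (C * X).trace * Complex.exp (Complex.I * ω * t) +
        0 * Complex.exp (-(Complex.I * ω) * t) := fun C t => by
    rw [zero_mul, add_zero, zero_add, ← expectation_eigen C hX, expectation,
      trace_mul_flow_liouvillian]
    rfl
  refine ⟨fun c h => ?_, fun h => ?_⟩
  · have h1 := h.map T
    simp only [hT] at h1
    exact not_eventuallyEq_const_of_oscillating hω _ hB _ _ h1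
  · have h1 := h.map T
    simp only [fun t => (hasDerivAt_heisenberg H L B t).deriv, hT] at h1
    refine not_eventuallyEq_const_of_oscillating hω _ ?_ _ _ h1
    rw [← trace_mul_liouvillian, hX, Matrix.mul_smul, trace_smul, smul_eq_mul]
    exact mul_ne_zero hω' hB

end Nonstationary

/-! ### The exchange operator on configurations. -/

section Composite

variable {ι : Type*} [DecidableEq ι] {κ : ι → Type*}

theorem exchangeConfig_left {j k : ι} (hjk : j ≠ k) (e : κ j ≃ κ k) (x : ∀ s, κ s) :
    exchangeConfig j k e x j = e.symm (x k) := by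
  rw [exchangeConfig, Function.update_of_ne hjk, Function.update_self]

theorem exchangeConfig_right (j k : ι) (e : κ j ≃ κ k) (x : ∀ s, κ s) :
    exchangeConfig j k e x k = e (x j) := by
  rw [exchangeConfig, Function.update_self]

theorem exchangeConfig_of_ne {j k s : ι} (hj : s ≠ j) (hk : s ≠ k) (e : κ j ≃ κ k)
    (x : ∀ s, κ s) : exchangeConfig j k e x s = x s := by
  rw [exchangeConfig, Function.update_of_ne hk, Function.update_of_ne hj]

theorem exchangeConfig_involutive {j k : ι} (hjk : j ≠ k) (e : κ j ≃ κ k) :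
    Function.Involutive (exchangeConfig j k e) := fun x => by
  ext s
  by_cases hj : s = j
  · subst hj
    rw [exchangeConfig_left hjk, exchangeConfig_right, e.symm_apply_apply]
  by_cases hk : s = k
  · subst hk
    rw [exchangeConfig_right, exchangeConfig_left hjk, e.apply_symm_apply]
  rw [exchangeConfig_of_ne hj hk, exchangeConfig_of_ne hj hk]

variable [Fintype ι] [∀ s, Fintype (κ s)] [∀ s, DecidableEq (κ s)]

theorem exchange_mul_apply {j k : ι} (hjk : j ≠ k) (e : κ j ≃ κ k)
    (M : Matrix (∀ s, κ s) (∀ s, κ s) ℂ) (x y : ∀ s, κ s) :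
    (exchange j k e * M) x y = M (exchangeConfig j k e x) y := by
  rw [mul_apply, Finset.sum_eq_single (exchangeConfig j k e x)]
  · simp [exchange, exchangeConfig_involutive hjk e x]
  · intro z _ hz
    have : x ≠ exchangeConfig j k e z := fun h =>
      hz (by rw [h, exchangeConfig_involutive hjk e z])
    simp [exchange, this]
  · simp

theorem mul_exchange_apply (j k : ι) (e : κ j ≃ κ k)
    (M : Matrix (∀ s, κ s) (∀ s, κ s) ℂ) (x y : ∀ s, κ s) :
    (M * exchange j k e) x y = M x (exchangeConfig j k e y) := by
  rw [mul_apply, Finset.sum_eq_single (exchangeConfig j k e y)]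
  · simp [exchange]
  · intro z _ hz
    simp [exchange, hz]
  · simp

theorem exchange_mul_self {j k : ι} (hjk : j ≠ k) (e : κ j ≃ κ k) :
    exchange j k e * exchange j k e = 1 := by
  ext x y
  rw [exchange_mul_apply hjk, exchange, of_apply, one_apply]
  simp only [(exchangeConfig_involutive hjk e).injective.eq_iff]

theorem onSubsystem_reindex {j k : ι} (hjk : j ≠ k) (e : κ j ≃ κ k)
    (O : Matrix (κ j) (κ j) ℂ) :
    onSubsystem k (O.reindex e e) = exchange j k e * onSubsystem j O * exchange j k e := by
  ext x y
  rw [mul_exchange_apply, exchange_mul_apply hjk]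
  simp only [onSubsystem, of_apply, reindex_apply, submatrix_apply, exchangeConfig_left hjk]
  refine if_congr ⟨fun h s hs => ?_, fun h s hs => ?_⟩ rfl rfl
  · by_cases hk : s = k
    · subst hk
      rw [exchangeConfig_right, exchangeConfig_right, h j hjk]
    · rw [exchangeConfig_of_ne hs hk, exchangeConfig_of_ne hs hk, h s hk]
  · by_cases hj : s = j
    · subst hj
      have := h k hs.symm
      rwa [exchangeConfig_right, exchangeConfig_right, e.apply_eq_iff_eq] at this
    · have := h s hj
      rwa [exchangeConfig_of_ne hj hs, exchangeConfig_of_ne hj hs] at this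

end Composite

end QuantumSync

end

theorem corollary2
    {ι : Type*} [Fintype ι] [DecidableEq ι]
    {κ : ι → Type*} [∀ s, Fintype (κ s)] [∀ s, DecidableEq (κ s)]
    {μ : Type*} [Fintype μ]
    (H : Matrix (∀ s, κ s) (∀ s, κ s) ℂ) (hH : H.IsHermitian)
    (L : μ → Matrix (∀ s, κ s) (∀ s, κ s) ℂ)
    (j k : ι) (hjk : j ≠ k) (e : κ j ≃ κ k)
    (O : Matrix (κ j) (κ j) ℂ)
    (h_weak : QuantumSync.IsWeakSymmetry H L (QuantumSync.exchange j k e))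
    (h_exists : ∃ A ρ ω, ω ≠ 0 ∧ QuantumSync.IsOscillating H L A ρ ω)
    (h_trace : ∃ A ρ ω, ω ≠ 0 ∧ QuantumSync.IsOscillating H L A ρ ω ∧
      (QuantumSync.onSubsystem j O * A * ρ).trace ≠ 0)
    (h_comm : ∀ A ρ ω, QuantumSync.IsOscillating H L A ρ ω →
      (QuantumSync.exchange j k e * A - A * QuantumSync.exchange j k e) * ρ = 0) :
    QuantumSync.RobustlyStablySynchronized H L j k e O := by
  obtain ⟨A, ρ, ω, hω, hA, htr⟩ := h_trace
  rw [mul_assoc] at htr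
  have hPP := QuantumSync.exchange_mul_self hjk e
  have hOk := QuantumSync.onSubsystem_reindex hjk e O
  have hD : ∀ (ω : ℝ) (X : Matrix (∀ s, κ s) (∀ s, κ s) ℂ),
      QuantumSync.liouvillian H L X = (Complex.I * (ω : ℂ)) • X →
      ((QuantumSync.onSubsystem j O - QuantumSync.onSubsystem k (O.reindex e e)) * X).trace = 0 :=
    fun ω X hX => by
      have hPX := QuantumSync.conj_eq_self_of_eigen hH L hPP h_weak h_comm hX
      rw [sub_mul, trace_sub, sub_eq_zero]
      conv_lhs => rw [← hPX]
      rw [hOk, ← mul_assoc, trace_mul_comm]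
      simp only [mul_assoc]
  refine ⟨?_, ?_, ?_, QuantumSync.isNonstationary_heisenberg hA.liouvillian_eq hω htr⟩
  · obtain ⟨ρ₀, h₀, hns⟩ := QuantumSync.exists_isNonstationary_expectation hH hA hω htr
    refine ⟨ρ₀, h₀, QuantumSync.eventuallyEq_of_sub ?_, hns⟩
    have := QuantumSync.trace_mul_flow_decay hH L hD ρ₀
    simp only [sub_mul, trace_sub] at this
    exact this
  -- The weak symmetry alone makes this an exact identity at all times, with no transient.
  · have : QuantumSync.heisenberg H L (QuantumSync.onSubsystem j O) = fun t =>
        QuantumSync.exchange j k e *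
          QuantumSync.heisenberg H L (QuantumSync.onSubsystem k (O.reindex e e)) t *
          QuantumSync.exchange j k e := by
      ext1 t
      rw [QuantumSync.heisenberg, QuantumSync.heisenberg, hOk,
        QuantumSync.flow_adjointLiouvillian_conj L h_weak]
      simp only [mul_assoc, hPP, mul_one]
      rw [← mul_assoc, hPP, one_mul]
    rw [this]
    exact QuantumSync.EventuallyEq.refl _
  · refine QuantumSync.eventuallyEq_of_sub ?_
    have := QuantumSync.flow_adjointLiouvillian_decay hH L hD
    simp only [QuantumSync.flow, map_sub] at this
    exact this
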